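/- Let $X$ be a compact metrizable group with identity $e$, normalised Haar measure $\mu$ and a left-invariant metric $d$ inducing its topology. Let $m\ge 1$, let $A_0,\dots,A_{m-1}$ be continuous surjective endomorphisms of $X$, let $a_0,\dots,a_{m-1}\in X$, and put $g_i(x)=a_i\cdot A_i(x)$ for $0\le i\le m-1$. Notation. For a finite word $w=w_1w_2\cdots w_n$ in the symbols $0,\dots,m-1$ write $|w|=n$, and write $w'\le w$ if $w'$ is a nonempty suffix of $w$ ($w'=w$ allowed). For maps $f_0,\dots,f_{m-1}:X\to X$ let $f_w=f_{w_1}\circ f_{w_2}\circ\cdots\circ f_{w_n}$. For a finite Borel partition $\xi=\{C_1,\dots,C_k\}$ of $X$ let $H_\mu(\xi)=-\sum_{i}\mu(C_i)\log\mu(C_i)$ (with $0\log 0=0$), let $$h_\mu(f_0,\dots,f_{m-1},\xi)=\lim_{n\to\infty}\frac1n\left[\frac1{m^n}\sum_{|w|=n}H_\mu\Big(\bigvee_{w'\le w}f_{w'}^{-1}\xi\Big)\right],$$ and let $h_\mu(f_0,\dots,f_{m-1})\in[0,\infty]$ be the supremum of $h_\mu(f_0,\dots,f_{m-1},\xi)$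 over all finite Borel partitions $\xi$. For $\varepsilon>0$ let $D_w(e,\varepsilon)=\bigcap_{w'\le w}A_{w'}^{-1}(B_d(e,\varepsilon))$, where $B_d(e,\varepsilon)$ is the open $d$-ball. Theorem. For $f_i=g_i$ and for $f_i=A_i$ the limit defining $h_\mu(f_0,\dots,f_{m-1},\xi)$ exists for every finite Borel partition $\xi$; the two limits as $\varepsilon\to0$ below exist in $[0,\infty]$; and $$\lim_{\varepsilon\to 0}\limsup_{n\to\infty}\frac1n\left(\frac1{m^n}\sum_{|w|=n}\log\frac1{\mu(D_w(e,\varepsilon))}\right)\le h_\mu(g_0,\dots,g_{m-1})\le\lim_{\varepsilon\to 0}\limsup_{n\to\infty}\frac1n\log\left(\frac1{m^n}\sum_{|w|=n}\frac1{\mu(D_w(e,\varepsilon))}\right).$$ In particular, the same lower and upper bounds hold for $h_\mu(A_0,\dots,A_{m-1})$. -/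

import Mathlib

open MeasureTheory Filter Topology

noncomputable section

/-- The words `w'` with `w' ≤ w`: the nonempty suffixes of `w` (the word `w` itself included,
if it is nonempty). A word of length `n` has `n` of them. -/
def wordSuffixes {m : ℕ} (w : List (Fin m)) : Finset (List (Fin m)) :=
  w.tails.toFinset.erase []

theorem mem_wordSuffixes {m : ℕ} {w w' : List (Fin m)} :
    w' ∈ wordSuffixes w ↔ w' ≠ [] ∧ ∃ w'' : List (Fin m), w = w'' ++ w' := by
  simp only [wordSuffixes, Finset.mem_erase, List.mem_toFinset, List.mem_tails]
  exact and_congr_right fun _ => ⟨fun ⟨t, h⟩ => ⟨t, h.symm⟩, fun ⟨t, h⟩ => ⟨t, h.symm⟩⟩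

/-- `f_w = f_{w₁} ∘ f_{w₂} ∘ ⋯ ∘ f_{wₖ}` for a word `w = w₁ w₂ ⋯ wₖ`. -/
def wordMap {X : Type*} {m : ℕ} (f : Fin m → X → X) : List (Fin m) → X → X
  | [] => id
  | i :: w => f i ∘ wordMap f w

/-- The average `m⁻ⁿ ∑_{|w| = n} F(w)` over all words of length `n` in `m` symbols. -/
def wordAverage (m n : ℕ) (F : List (Fin m) → ℝ) : ℝ :=
  (1 / (m : ℝ) ^ n) * ∑ w : Fin n → Fin m, F (List.ofFn w)

/-- A finite measurable partition, listed as `k` pairwise disjoint measurable cells that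
cover the space (empty cells are allowed; they do not contribute to entropies). -/
structure MeasPartition (X : Type*) [MeasurableSpace X] (k : ℕ) where
  /-- the cells -/
  cell : Fin k → Set X
  measurableSet_cell : ∀ i, MeasurableSet (cell i)
  disjoint_cell : ∀ i j, i ≠ j → Disjoint (cell i) (cell j)
  iUnion_cell : ⋃ i, cell i = Set.univ

/-- The entropy `-∑ μ(Cᵢ) log μ(Cᵢ)` of a finite family of cells, with `0 log 0 = 0`. -/
def cellEntropy {X ι : Type*} [MeasurableSpace X] [Fintype ι] (μ : Measure X)
    (C : ι → Set X) : ℝ :=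
  -∑ i, μ.real (C i) * Real.log (μ.real (C i))

/-- The cells of the join of the partitions `f_{w'}⁻¹ ξ` over all `w' ≤ w`: for every choice
`c` of a cell of `ξ` for each `w'`, the intersection of the sets `f_{w'}⁻¹ (ξ_{c(w')})`. -/
def joinCells {X : Type*} [MeasurableSpace X] {m k : ℕ} (f : Fin m → X → X)
    (ξ : MeasPartition X k) (w : List (Fin m)) (c : ↥(wordSuffixes w) → Fin k) : Set X :=
  ⋂ w' : ↥(wordSuffixes w), wordMap f w'.1 ⁻¹' ξ.cell (c w')

/-- `(1/n) m⁻ⁿ ∑_{|w| = n} H_μ(⋁_{w' ≤ w} f_{w'}⁻¹ ξ)`. -/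
def entropyRate {X : Type*} [MeasurableSpace X] {m k : ℕ} (μ : Measure X)
    (f : Fin m → X → X) (ξ : MeasPartition X k) (n : ℕ) : ℝ :=
  (1 / (n : ℝ)) * wordAverage m n fun w => cellEntropy μ (joinCells f ξ w)

/-- `h_μ(f₀, …, f_{m-1}, ξ)`, the limit of `entropyRate` (for measure-preserving maps the upper
limit is a limit; the theorem states this too). -/
def partitionEntropy {X : Type*} [MeasurableSpace X] {m k : ℕ} (μ : Measure X)
    (f : Fin m → X → X) (ξ : MeasPartition X k) : EReal :=
  limsup (fun n : ℕ => ((entropyRate μ f ξ n : ℝ) : EReal)) atTop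

/-- The measure-theoretic entropy `h_μ(f₀, …, f_{m-1})` of the free semigroup action: the
supremum of `h_μ(f₀, …, f_{m-1}, ξ)` over all finite measurable partitions `ξ`. -/
def semigroupEntropy {X : Type*} [MeasurableSpace X] {m : ℕ} (μ : Measure X)
    (f : Fin m → X → X) : EReal :=
  ⨆ (k : ℕ) (ξ : MeasPartition X k), partitionEntropy μ f ξ

/-- `D_w(e, ε, f₀, …, f_{m-1}) = ⋂_{w' ≤ w} f_{w'}⁻¹ (B(e, ε))`. -/
def bowenBall {X : Type*} [One X] [PseudoMetricSpace X] {m : ℕ} (f : Fin m → X → X)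
    (w : List (Fin m)) (ε : ℝ) : Set X :=
  ⋂ w' ∈ wordSuffixes w, wordMap f w' ⁻¹' Metric.ball 1 ε

/-- `limsup_n (1/n) m⁻ⁿ ∑_{|w| = n} log (1 / μ(D_w(e, ε)))`. -/
def lowerRate {X : Type*} [One X] [PseudoMetricSpace X] [MeasurableSpace X] {m : ℕ}
    (μ : Measure X) (f : Fin m → X → X) (ε : ℝ) : EReal :=
  limsup (fun n : ℕ => (((1 / (n : ℝ)) *
    wordAverage m n fun w => Real.log (1 / μ.real (bowenBall f w ε)) : ℝ) : EReal)) atTop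

/-- `limsup_n (1/n) log (m⁻ⁿ ∑_{|w| = n} 1 / μ(D_w(e, ε)))`. -/
def upperRate {X : Type*} [One X] [PseudoMetricSpace X] [MeasurableSpace X] {m : ℕ}
    (μ : Measure X) (f : Fin m → X → X) (ε : ℝ) : EReal :=
  limsup (fun n : ℕ => (((1 / (n : ℝ)) *
    Real.log (wordAverage m n fun w => 1 / μ.real (bowenBall f w ε)) : ℝ) : EReal)) atTop

/-- The maps `g_i = a_i · A_i`. -/
def affineMaps {X : Type*} [Group X] {m : ℕ} (a : Fin m → X) (A : Fin m → X →* X)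
    (i : Fin m) (x : X) : X :=
  a i * A i x

end

/-! The constants `a i` cancel in quotients: `g_w(x)⁻¹ g_w(y) = A_w(x⁻¹ y)`. With left invariance of
`d`, the points that stay `ε`-close to `x` along all suffixes of `w` form the translate `x · D_w(e,
ε)`, whose measure depends neither on `x` nor on `a`.

Lower bound: if the cells of `ξ` have diameter below `ε`, every cell of the join lies in such a
translate, so the entropy of the join is at least `log (1 / μ(D_w))`.

Upper bound: `cellEntropy_code_le` applies Gibbs' inequality to a reference distribution on
itineraries: pick `y` at random and read its itinerary with noise. The itinerary of `x` receives at
least the contribution of the `y` in `x · D_w`, and this costs `log (1 / μ(D_w))` plus an error that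
is small per letter. Hence the entropy is even at most the limit of `lowerRate`; Jensen's inequality
for `log` then gives `upperRate`.

The limits in `n` come from Fekete's lemma, those in `ε` from monotonicity. -/

/-! ### Entropy of finite-valued measurable maps -/

section Gibbs

variable {ι : Type*} [Fintype ι]

/-- Gibbs' inequality: the entropy of a probability vector is at most its cross entropy relative
to any sub-probability vector. -/
theorem neg_sum_mul_log_le_neg_sum_mul_log {P Q : ι → ℝ} (hP : ∀ i, 0 ≤ P i)
    (hQ : ∀ i, 0 ≤ Q i) (hPQ : ∀ i, 0 < P i → 0 < Q i) (hQP : ∑ i, Q i ≤ ∑ i, P i) :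
    -∑ i, P i * Real.log (P i) ≤ -∑ i, P i * Real.log (Q i) := by
  have key : ∀ i, P i * Real.log (Q i) - P i * Real.log (P i) ≤ Q i - P i := by
    intro i
    rcases (hP i).eq_or_lt with h | h
    · rw [← h]; simpa using hQ i
    · have hq := hPQ i h
      have h1 := Real.log_le_sub_one_of_pos (div_pos hq h)
      rw [Real.log_div hq.ne' h.ne'] at h1
      have h2 := mul_le_mul_of_nonneg_left h1 h.le
      have h3 : P i * (Q i / P i - 1) = Q i - P i := by field_simp
      linarith
  have := Finset.sum_le_sum fun i (_ : i ∈ Finset.univ) => key i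
  simp only [Finset.sum_sub_distrib] at this
  linarith

end Gibbs

section Cells

variable {X ι κ : Type*} [MeasurableSpace X] {μ : Measure X} [Fintype ι] [Fintype κ]

theorem cellEntropy_comp_equiv (e : κ ≃ ι) (C : ι → Set X) :
    cellEntropy μ (fun c => C (e c)) = cellEntropy μ C := by
  unfold cellEntropy
  rw [Equiv.sum_comp e fun c => μ.real (C c) * Real.log (μ.real (C c))]

theorem cellEntropy_nonneg [IsProbabilityMeasure μ] (C : ι → Set X) : 0 ≤ cellEntropy μ C := by
  unfold cellEntropy
  rw [neg_nonneg]
  exact Finset.sum_nonpos fun c _ =>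
    mul_nonpos_of_nonneg_of_nonpos measureReal_nonneg
      (Real.log_nonpos measureReal_nonneg measureReal_le_one)

end Cells

section Code

variable {X ι κ : Type*} [MeasurableSpace X] {μ : Measure X}
  [Fintype ι] [MeasurableSpace ι] [MeasurableSingletonClass ι]
  [Fintype κ] [MeasurableSpace κ] [MeasurableSingletonClass κ]

theorem sum_measureReal_fiber_mul [IsFiniteMeasure μ] {φ : X → ι} (hφ : Measurable φ)
    (F : ι → ℝ) : ∑ c, μ.real (φ ⁻¹' {c}) * F c = ∫ x, F (φ x) ∂μ := by
  have hF : Measurable F := measurable_of_finite F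
  rw [← integral_map hφ.aemeasurable hF.aestronglyMeasurable, integral_fintype Integrable.of_finite]
  refine Finset.sum_congr rfl fun c _ => ?_
  rw [map_measureReal_apply hφ (measurableSet_singleton c), smul_eq_mul]

theorem sum_measureReal_fiber [IsProbabilityMeasure μ] {φ : X → ι} (hφ : Measurable φ) :
    ∑ c, μ.real (φ ⁻¹' {c}) = 1 := by
  simpa using sum_measureReal_fiber_mul (μ := μ) hφ fun _ => 1

/-- The cross entropy is written as an integral so that a pointwise bound on `-log Q(φ x)` can be
integrated. -/
theorem cellEntropy_le_of_gibbs [IsProbabilityMeasure μ] {φ : X → ι} (hφ : Measurable φ)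
    {Q : ι → ℝ} (hQ : ∀ c, 0 ≤ Q c) (hPQ : ∀ c, 0 < μ.real (φ ⁻¹' {c}) → 0 < Q c)
    (hQ1 : ∑ c, Q c ≤ 1) :
    cellEntropy μ (fun c => φ ⁻¹' {c}) ≤ ∫ x, -Real.log (Q (φ x)) ∂μ := by
  rw [integral_neg, ← sum_measureReal_fiber_mul hφ fun c => Real.log (Q c)]
  exact neg_sum_mul_log_le_neg_sum_mul_log (fun _ => measureReal_nonneg) hQ hPQ
    (hQ1.trans_eq (sum_measureReal_fiber hφ).symm)

/-- Gibbs' inequality for the joint law against the product of its marginals. -/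
theorem cellEntropy_prod_le [IsProbabilityMeasure μ] {φ : X → ι} {ψ : X → κ}
    (hφ : Measurable φ) (hψ : Measurable ψ) :
    cellEntropy μ (fun c : ι × κ => (fun x => (φ x, ψ x)) ⁻¹' {c}) ≤
      cellEntropy μ (fun c => φ ⁻¹' {c}) + cellEntropy μ (fun c => ψ ⁻¹' {c}) := by
  have hsub1 : ∀ c : ι × κ, (fun x => (φ x, ψ x)) ⁻¹' {c} ⊆ φ ⁻¹' {c.1} := by
    rintro ⟨a, b⟩ x hx; simp_all
  have hsub2 : ∀ c : ι × κ, (fun x => (φ x, ψ x)) ⁻¹' {c} ⊆ ψ ⁻¹' {c.2} := by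
    rintro ⟨a, b⟩ x hx; simp_all
  have hp1 : ∀ c : ι × κ, 0 < μ.real ((fun x => (φ x, ψ x)) ⁻¹' {c}) →
      0 < μ.real (φ ⁻¹' {c.1}) := fun c hc => hc.trans_le (measureReal_mono (hsub1 c))
  have hp2 : ∀ c : ι × κ, 0 < μ.real ((fun x => (φ x, ψ x)) ⁻¹' {c}) →
      0 < μ.real (ψ ⁻¹' {c.2}) := fun c hc => hc.trans_le (measureReal_mono (hsub2 c))
  have hφψ : Measurable fun x => (φ x, ψ x) := hφ.prodMk hψ
  have h := neg_sum_mul_log_le_neg_sum_mul_log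
    (P := fun c : ι × κ => μ.real ((fun x => (φ x, ψ x)) ⁻¹' {c}))
    (Q := fun c : ι × κ => μ.real (φ ⁻¹' {c.1}) * μ.real (ψ ⁻¹' {c.2}))
    (fun _ => measureReal_nonneg) (fun _ => by positivity)
    (fun c hc => mul_pos (hp1 c hc) (hp2 c hc))
    (by rw [sum_measureReal_fiber hφψ, Fintype.sum_prod_type]
        simp only [← Finset.sum_mul_sum, sum_measureReal_fiber hφ, sum_measureReal_fiber hψ,
          one_mul, le_refl])
  refine h.trans_eq ?_
  have hlog : ∀ c : ι × κ, μ.real ((fun x => (φ x, ψ x)) ⁻¹' {c}) *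
        Real.log (μ.real (φ ⁻¹' {c.1}) * μ.real (ψ ⁻¹' {c.2})) =
      μ.real ((fun x => (φ x, ψ x)) ⁻¹' {c}) * Real.log (μ.real (φ ⁻¹' {c.1})) +
      μ.real ((fun x => (φ x, ψ x)) ⁻¹' {c}) * Real.log (μ.real (ψ ⁻¹' {c.2})) := by
    intro c
    rcases (measureReal_nonneg (μ := μ) (s := (fun x => (φ x, ψ x)) ⁻¹' {c})).eq_or_lt with h | h
    · rw [← h]; simp
    · rw [Real.log_mul (hp1 c h).ne' (hp2 c h).ne', mul_add]
  simp only [hlog, Finset.sum_add_distrib, cellEntropy]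
  rw [sum_measureReal_fiber_mul hφψ fun c : ι × κ => Real.log (μ.real (φ ⁻¹' {c.1})),
    sum_measureReal_fiber_mul hφψ fun c : ι × κ => Real.log (μ.real (ψ ⁻¹' {c.2})),
    sum_measureReal_fiber_mul hφ fun c => Real.log (μ.real (φ ⁻¹' {c})),
    sum_measureReal_fiber_mul hψ fun c => Real.log (μ.real (ψ ⁻¹' {c}))]
  ring

theorem cellEntropy_preimage {Y : Type*} [MeasurableSpace Y] {ν : Measure Y} {F : X → Y}
    (hF : MeasurePreserving F μ ν) {φ : Y → ι} (hφ : Measurable φ) :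
    cellEntropy μ (fun c => (fun x => φ (F x)) ⁻¹' {c}) =
      cellEntropy ν (fun c => φ ⁻¹' {c}) := by
  unfold cellEntropy
  have : ∀ c, μ.real ((fun x => φ (F x)) ⁻¹' {c}) = ν.real (φ ⁻¹' {c}) := fun c =>
    hF.measureReal_preimage (hφ (measurableSet_singleton c)).nullMeasurableSet
  simp only [this]

theorem log_one_div_le_cellEntropy [IsProbabilityMeasure μ] {φ : X → ι} (hφ : Measurable φ)
    {r : ℝ} (h : ∀ c, μ.real (φ ⁻¹' {c}) ≤ r) :
    Real.log (1 / r) ≤ cellEntropy μ (fun c => φ ⁻¹' {c}) := by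
  have key : ∀ c, μ.real (φ ⁻¹' {c}) * Real.log (μ.real (φ ⁻¹' {c})) ≤
      μ.real (φ ⁻¹' {c}) * Real.log r := by
    intro c
    rcases (measureReal_nonneg (μ := μ) (s := φ ⁻¹' {c})).eq_or_lt with h0 | h0
    · rw [← h0]; simp
    · exact mul_le_mul_of_nonneg_left (Real.log_le_log h0 (h c)) h0.le
  have := Finset.sum_le_sum fun c (_ : c ∈ Finset.univ) => key c
  rw [← Finset.sum_mul, sum_measureReal_fiber hφ, one_mul] at this
  rw [one_div, Real.log_inv, cellEntropy]
  linarith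

end Code

/-! ### The cells of a join -/

theorem wordMap_append {X : Type*} {m : ℕ} (f : Fin m → X → X) (u v : List (Fin m)) (x : X) :
    wordMap f (u ++ v) x = wordMap f u (wordMap f v x) := by
  induction u with
  | nil => rfl
  | cons i u ih => simp [wordMap, ih]

section Join

variable {X : Type*} [MeasurableSpace X] {m k : ℕ}

theorem MeasPartition.exists_mem_cell (ξ : MeasPartition X k) (x : X) : ∃ i, x ∈ ξ.cell i := by
  simpa using (Set.ext_iff.1 ξ.iUnion_cell x).2 trivial

/-- The index of the cell that contains a given point. -/
noncomputable def MeasPartition.code (ξ : MeasPartition X k) (x : X) : Fin k :=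
  (ξ.exists_mem_cell x).choose

theorem MeasPartition.code_eq_iff (ξ : MeasPartition X k) {x : X} {i : Fin k} :
    ξ.code x = i ↔ x ∈ ξ.cell i := by
  have h := (ξ.exists_mem_cell x).choose_spec
  refine ⟨fun hi => hi ▸ h, fun hi => ?_⟩
  by_contra hne
  exact Set.disjoint_left.1 (ξ.disjoint_cell _ _ hne) h hi

theorem MeasPartition.measurable_code (ξ : MeasPartition X k) : Measurable ξ.code :=
  measurable_to_countable' fun i => by
    have : ξ.code ⁻¹' {i} = ξ.cell i := by ext x; simp [ξ.code_eq_iff]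
    rw [this]; exact ξ.measurableSet_cell i

/-- The itinerary of a point: the cells visited by its images under the suffixes of a word. -/
noncomputable def itinerary (f : Fin m → X → X) (ξ : MeasPartition X k) (w : List (Fin m)) (x : X)
    (t : ↥(wordSuffixes w)) : Fin k :=
  ξ.code (wordMap f t.1 x)

theorem joinCells_eq (f : Fin m → X → X) (ξ : MeasPartition X k) (w : List (Fin m)) :
    joinCells f ξ w = fun c => itinerary f ξ w ⁻¹' {c} := by
  funext c
  ext x
  simp [joinCells, itinerary, funext_iff, ← ξ.code_eq_iff]

theorem MeasurePreserving.wordMap {μ : Measure X} {f : Fin m → X → X}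
    (hf : ∀ i, MeasurePreserving (f i) μ μ) :
    ∀ w : List (Fin m), MeasurePreserving (wordMap f w) μ μ
  | [] => MeasurePreserving.id μ
  | i :: w => (hf i).comp (MeasurePreserving.wordMap hf w)

theorem measurable_itinerary {μ : Measure X} {f : Fin m → X → X}
    (hf : ∀ i, MeasurePreserving (f i) μ μ) (ξ : MeasPartition X k) (w : List (Fin m)) :
    Measurable (itinerary f ξ w) :=
  measurable_pi_lambda _ fun t =>
    ξ.measurable_code.comp (MeasurePreserving.wordMap hf t.1).measurable

theorem mem_wordSuffixes_append {u v t : List (Fin m)} :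
    t ∈ wordSuffixes (u ++ v) ↔ t ∈ wordSuffixes v ∨ ∃ s ∈ wordSuffixes u, t = s ++ v := by
  simp only [mem_wordSuffixes]
  constructor
  · rintro ⟨ht, r, hr⟩
    rcases List.append_eq_append_iff.1 hr with ⟨s, rfl, hs⟩ | ⟨s, rfl, rfl⟩
    · exact Or.inl ⟨ht, s, hs⟩
    -- If `s` is empty then `t = v`, which belongs to the first alternative because suffixes are
    -- nonempty.
    · rcases eq_or_ne s [] with rfl | hs
      · exact Or.inl ⟨ht, [], by simp⟩
      · exact Or.inr ⟨s, ⟨hs, r, rfl⟩, rfl⟩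
  · rintro (⟨ht, r, rfl⟩ | ⟨s, ⟨hs, r, rfl⟩, rfl⟩)
    · exact ⟨ht, u ++ r, by simp⟩
    · exact ⟨by simp [hs], r, by simp⟩

/-- The suffixes of `u ++ v` are those of `v`, and the words `s ++ v` for `s` a suffix of `u`. -/
noncomputable def wordSuffixesAppendEquiv (u v : List (Fin m)) :
    ↥(wordSuffixes v) ⊕ ↥(wordSuffixes u) ≃ ↥(wordSuffixes (u ++ v)) :=
  Equiv.ofBijective
    (Sum.elim (fun t => ⟨t.1, mem_wordSuffixes_append.2 (Or.inl t.2)⟩)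
      (fun s => ⟨s.1 ++ v, mem_wordSuffixes_append.2 (Or.inr ⟨s.1, s.2, rfl⟩)⟩)) <| by
    have hne : ∀ (t : ↥(wordSuffixes v)) (s : ↥(wordSuffixes u)), t.1 ≠ s.1 ++ v := by
      rintro ⟨t, ht⟩ ⟨s, hs⟩ (h : t = s ++ v)
      obtain ⟨-, r, hr⟩ := mem_wordSuffixes.1 ht
      have h1 := congrArg List.length hr
      have h2 := List.length_pos_iff.2 (mem_wordSuffixes.1 hs).1
      simp only [h, List.length_append] at h1
      omega
    constructor
    · rintro (t | t) (s | s) h <;> simp only [Sum.elim_inl, Sum.elim_inr, Subtype.mk.injEq] at h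
      · exact congrArg _ (Subtype.ext h)
      · exact (hne t s h).elim
      · exact (hne s t h.symm).elim
      · exact congrArg _ (Subtype.ext (List.append_cancel_right h))
    · rintro ⟨t, ht⟩
      rcases mem_wordSuffixes_append.1 ht with h | ⟨s, hs, rfl⟩
      · exact ⟨Sum.inl ⟨t, h⟩, rfl⟩
      · exact ⟨Sum.inr ⟨s, hs⟩, rfl⟩

theorem card_wordSuffixes (w : List (Fin m)) : (wordSuffixes w).card = w.length := by
  induction w with
  | nil => rfl
  | cons i w ih =>
    have h := Fintype.card_congr (wordSuffixesAppendEquiv [i] w)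
    have h1 : (wordSuffixes [i]).card = 1 := rfl
    simp only [Fintype.card_sum, Fintype.card_coe, ih, h1] at h
    simpa using h.symm

/-- Since `f_{sv} = f_s ∘ f_v`, the join along `u ++ v` is the join along `v` refined by the
`f_v`-preimage of the join along `u`, and `f_v` preserves `μ`. -/
theorem cellEntropy_joinCells_append_le {μ : Measure X} [IsProbabilityMeasure μ]
    {f : Fin m → X → X} (hf : ∀ i, MeasurePreserving (f i) μ μ) (ξ : MeasPartition X k)
    (u v : List (Fin m)) :
    cellEntropy μ (joinCells f ξ (u ++ v)) ≤
      cellEntropy μ (joinCells f ξ u) + cellEntropy μ (joinCells f ξ v) := by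
  have hv := MeasurePreserving.wordMap hf v
  have hu := measurable_itinerary hf ξ u
  have h := cellEntropy_prod_le (μ := μ) (measurable_itinerary hf ξ v) (hu.comp hv.measurable)
  simp only [joinCells_eq]
  rw [add_comm, ← cellEntropy_preimage hv hu]
  refine le_of_eq_of_le ?_ h
  let e : ((↥(wordSuffixes v) → Fin k) × (↥(wordSuffixes u) → Fin k)) ≃
      (↥(wordSuffixes (u ++ v)) → Fin k) :=
    (Equiv.sumArrowEquivProdArrow _ _ _).symm.trans
      (Equiv.arrowCongr (wordSuffixesAppendEquiv u v) (Equiv.refl _))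
  rw [← cellEntropy_comp_equiv e]
  congr 1
  funext c
  ext x
  simp only [Set.mem_preimage, Set.mem_singleton_iff]
  rw [← e.symm_apply_eq, Prod.ext_iff, Prod.ext_iff]
  have h1 : (e.symm (itinerary f ξ (u ++ v) x)).1 = itinerary f ξ v x := rfl
  have h2 : (e.symm (itinerary f ξ (u ++ v) x)).2 = itinerary f ξ u (wordMap f v x) := by
    funext s
    exact congrArg ξ.code (wordMap_append f s.1 v x)
  rw [h1, h2]
  rfl

end Join

/-! ### Averages over words -/

section Average

variable {m n : ℕ} {F G : List (Fin m) → ℝ}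

theorem wordAverage_mono (h : ∀ w : List (Fin m), w.length = n → F w ≤ G w) :
    wordAverage m n F ≤ wordAverage m n G :=
  mul_le_mul_of_nonneg_left (Finset.sum_le_sum fun w _ => h _ (List.length_ofFn (f := w)))
    (by positivity)

theorem wordAverage_nonneg (h : ∀ w, 0 ≤ F w) : 0 ≤ wordAverage m n F :=
  mul_nonneg (by positivity) (Finset.sum_nonneg fun _ _ => h _)

theorem wordAverage_add : wordAverage m n (fun w => F w + G w) =
    wordAverage m n F + wordAverage m n G := by
  simp only [wordAverage, Finset.sum_add_distrib, mul_add]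

theorem wordAverage_const (hm : 1 ≤ m) (c : ℝ) : wordAverage m n (fun _ => c) = c := by
  have : (m : ℝ) ≠ 0 := by positivity
  simp [wordAverage]
  field_simp

theorem wordAverage_pos (hm : 1 ≤ m) (h : ∀ w, 0 < F w) : 0 < wordAverage m n F := by
  have : Nonempty (Fin m) := ⟨⟨0, hm⟩⟩
  have : (0 : ℝ) < m := by positivity
  exact mul_pos (by positivity) (Finset.sum_pos (fun _ _ => h _) Finset.univ_nonempty)

/-- A uniform word of length `p + q` is a pair of independent uniform words of lengths `p` and `q`.
-/
theorem wordAverage_append_le (hm : 1 ≤ m) (hF : ∀ u v, F (u ++ v) ≤ F u + F v) (p q : ℕ) :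
    wordAverage m (p + q) F ≤ wordAverage m p F + wordAverage m q F := by
  have hm0 : (m : ℝ) ≠ 0 := by positivity
  unfold wordAverage
  rw [← (Fin.appendEquiv p q).sum_comp, Fintype.sum_prod_type]
  have h : ∑ u : Fin p → Fin m, ∑ v : Fin q → Fin m,
      F (List.ofFn (Fin.appendEquiv p q (u, v))) ≤
      ∑ u : Fin p → Fin m, ∑ v : Fin q → Fin m, (F (List.ofFn u) + F (List.ofFn v)) := by
    refine Finset.sum_le_sum fun u _ => Finset.sum_le_sum fun v _ => ?_
    have h := hF (List.ofFn u) (List.ofFn v)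
    rwa [← List.ofFn_fin_append] at h
  refine (mul_le_mul_of_nonneg_left h (by positivity)).trans_eq ?_
  simp [Finset.sum_add_distrib, ← Finset.mul_sum, pow_add]
  field_simp

theorem wordAverage_log_le (hm : 1 ≤ m) (h : ∀ w, 0 < F w) :
    wordAverage m n (fun w => Real.log (F w)) ≤ Real.log (wordAverage m n F) := by
  have hm0 : (m : ℝ) ≠ 0 := by positivity
  have := strictConcaveOn_log_Ioi.concaveOn.le_map_sum (t := Finset.univ)
    (w := fun _ : Fin n → Fin m => 1 / (m : ℝ) ^ n) (p := fun w => F (List.ofFn w))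
    (fun _ _ => by positivity) (by simp; field_simp) (fun w _ => h _)
  simp only [smul_eq_mul, ← Finset.mul_sum] at this
  exact this

end Average

/-! ### Existence of the entropy of a partition -/

theorem tendsto_entropyRate {X : Type*} [MeasurableSpace X] {μ : Measure X}
    [IsProbabilityMeasure μ] {m k : ℕ} (hm : 1 ≤ m) {f : Fin m → X → X}
    (hf : ∀ i, MeasurePreserving (f i) μ μ) (ξ : MeasPartition X k) :
    Tendsto (fun n : ℕ => ((entropyRate μ f ξ n : ℝ) : EReal)) atTop
      (𝓝 (partitionEntropy μ f ξ)) := by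
  have hsub : Subadditive fun n => wordAverage m n fun w => cellEntropy μ (joinCells f ξ w) :=
    fun p q => wordAverage_append_le hm (cellEntropy_joinCells_append_le hf ξ) p q
  have hlim := hsub.tendsto_lim ⟨0, by
    rintro _ ⟨n, rfl⟩
    exact div_nonneg (wordAverage_nonneg fun w => cellEntropy_nonneg _) n.cast_nonneg⟩
  have h : Tendsto (fun n : ℕ => ((entropyRate μ f ξ n : ℝ) : EReal)) atTop
      (𝓝 ((hsub.lim : ℝ) : EReal)) := by
    refine (continuous_coe_real_ereal.tendsto _).comp (hlim.congr fun n => ?_)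
    rw [entropyRate, one_div, inv_mul_eq_div]
  rwa [partitionEntropy, h.limsup_eq]

/-! ### Entropy of itineraries and the measure of Bowen neighbourhoods -/

section Itinerary

variable {X : Type*} [MeasurableSpace X] {μ : Measure X} [IsProbabilityMeasure μ] {k : ℕ}

/-- Finitely many disjoint measurable cells are approximated from inside, in measure, by sets with
disjoint neighbourhoods of a uniform size. -/
theorem MeasPartition.exists_separated_approx [MetricSpace X] [CompactSpace X] [BorelSpace X]
    (ξ : MeasPartition X k) {η : ℝ} (hη : 0 < η) :
    ∃ ε > 0, ∃ K V : Fin k → Set X, (∀ i, MeasurableSet (K i)) ∧ (∀ i, MeasurableSet (V i)) ∧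
      (∀ i, K i ⊆ ξ.cell i) ∧ (∀ i j, i ≠ j → Disjoint (V i) (V j)) ∧
      (∀ i, ∀ x ∈ K i, ∀ y, dist x y < ε → y ∈ V i) ∧ μ.real (⋃ i, K i)ᶜ ≤ η := by
  -- Each of the `k` cells may lose this much; `k + 1` keeps the denominator positive.
  have hη' : ENNReal.ofReal (η / (k + 1)) ≠ 0 := by
    rw [Ne, ENNReal.ofReal_eq_zero, not_le]; positivity
  choose K hKξ hK hμK using fun i =>
    (ξ.measurableSet_cell i).exists_isCompact_sdiff_lt (measure_ne_top μ _) hη'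
  have hev : ∀ i j, ∃ δ > 0, i ≠ j →
      Disjoint (Metric.thickening δ (K i)) (Metric.thickening δ (K j)) := by
    intro i j
    by_cases hij : i = j
    · exact ⟨1, one_pos, fun h => (h hij).elim⟩
    · obtain ⟨δ, hδ, h⟩ := ((ξ.disjoint_cell i j hij).mono (hKξ i) (hKξ j)).exists_thickenings
        (hK i) (hK j).isClosed
      exact ⟨δ, hδ, fun _ => h⟩
  choose δ hδ hdis using hev
  have hex : ∃ ε > 0, ∀ i j, ε ≤ δ i j := by
    have : ∀ᶠ ε in 𝓝[>] (0 : ℝ), ∀ i j, ε ≤ δ i j :=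
      eventually_all.2 fun i => eventually_all.2 fun j =>
        eventually_nhdsWithin_of_eventually_nhds (eventually_le_nhds (hδ i j))
    obtain ⟨ε, h1, h2⟩ := (this.and self_mem_nhdsWithin).exists
    exact ⟨ε, h2, h1⟩
  obtain ⟨ε, hε, hεδ⟩ := hex
  refine ⟨ε, hε, K, fun i => Metric.thickening ε (K i), fun i => (hK i).measurableSet,
    fun i => Metric.isOpen_thickening.measurableSet, hKξ, fun i j hij => ?_,
    fun i x hx y hxy => Metric.mem_thickening_iff.2 ⟨x, hx, by rwa [dist_comm]⟩, ?_⟩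
  · exact (hdis i j hij).mono (Metric.thickening_mono (hεδ i j) _)
      (Metric.thickening_mono (hεδ i j) _)
  · have hsub : (⋃ i, K i)ᶜ ⊆ ⋃ i, ξ.cell i \ K i := by
      intro x hx
      obtain ⟨i, hi⟩ := ξ.exists_mem_cell x
      exact Set.mem_iUnion.2 ⟨i, hi, fun h => hx (Set.mem_iUnion.2 ⟨i, h⟩)⟩
    calc μ.real (⋃ i, K i)ᶜ ≤ μ.real (⋃ i, ξ.cell i \ K i) := measureReal_mono hsub
      _ ≤ ∑ i, μ.real (ξ.cell i \ K i) := measureReal_iUnion_fintype_le _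
      _ ≤ ∑ _i : Fin k, η / (k + 1) := Finset.sum_le_sum fun i _ =>
          ENNReal.toReal_le_of_le_ofReal (by positivity) (hμK i).le
      _ ≤ η := by
          simp only [Finset.sum_const, Finset.card_univ, Fintype.card_fin, nsmul_eq_mul]
          rw [mul_div_assoc', div_le_iff₀ (by positivity)]
          nlinarith

/-- The upper bound on entropy. A visit to `⋃ K i` costs at most `κ`, any other visit at most `M`;
invariance of `μ` makes the expected number of the latter `card T * μ(B)`. -/
theorem cellEntropy_code_le [PseudoMetricSpace X] {T : Type*} [Fintype T] [DecidableEq T]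
    {F : T → X → X} (hF : ∀ t, MeasurePreserving (F t) μ μ) (ξ : MeasPartition X k)
    {K V : Fin k → Set X} (hK : ∀ i, MeasurableSet (K i)) (hV : ∀ i, MeasurableSet (V i))
    (hKξ : ∀ i, K i ⊆ ξ.cell i) (hVd : ∀ i j, i ≠ j → Disjoint (V i) (V j)) {ε : ℝ}
    (hKV : ∀ i, ∀ x ∈ K i, ∀ y, dist x y < ε → y ∈ V i)
    {N : X → Set X} (hN : ∀ x, MeasurableSet (N x)) {r : ℝ} (hr : 0 < r)
    (hNr : ∀ x, r ≤ μ.real (N x)) (hNF : ∀ x, ∀ y ∈ N x, ∀ t, dist (F t x) (F t y) < ε)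
    {κ M : ℝ} (hκ : 0 < κ) (hM : Real.exp (-M) ≤ (1 - Real.exp (-κ)) / k) :
    cellEntropy μ (fun c : T → Fin k => (fun x t => ξ.code (F t x)) ⁻¹' {c}) ≤
      Real.log (1 / r) + Fintype.card T * (κ + M * μ.real (⋃ i, K i)ᶜ) := by
  set B : Set X := (⋃ i, K i)ᶜ with hB
  have hBm : MeasurableSet B := (MeasurableSet.iUnion hK).compl
  have hφ : Measurable fun x t => ξ.code (F t x) :=
    measurable_pi_lambda _ fun t => ξ.measurable_code.comp (hF t).measurable
  have heκ : Real.exp (-κ) < 1 := by simpa using hκ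
  -- The noisy reading of `y`: the index of the `V j` containing it, if any, has weight `exp (-κ)`,
  -- and the remaining mass is spread evenly so that no symbol is too unlikely.
  let q : Fin k → X → ℝ := fun j y =>
    Real.exp (-κ) * (V j).indicator 1 y + (1 - Real.exp (-κ)) / k
  have hqm : ∀ j, Measurable (q j) := fun j =>
    ((measurable_one.indicator (hV j)).const_mul _).add_const _
  have hq0 : ∀ j y, Real.exp (-M) ≤ q j y := fun j y =>
    hM.trans (le_add_of_nonneg_left (mul_nonneg (Real.exp_pos _).le
      (Set.indicator_nonneg (fun _ _ => zero_le_one) _)))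
  have hqpos : ∀ j y, 0 < q j y := fun j y => (Real.exp_pos _).trans_le (hq0 j y)
  have hqsum : ∀ y, ∑ j, q j y ≤ 1 := by
    intro y
    have hind : ∑ j, (V j).indicator (1 : X → ℝ) y ≤ 1 := by
      by_cases hy : ∃ i, y ∈ V i
      · obtain ⟨i, hi⟩ := hy
        rw [Finset.sum_eq_single i]
        · simp [hi]
        · intro j _ hji
          exact Set.indicator_of_notMem (fun h => Set.disjoint_left.1 (hVd j i hji) h hi) _
        · simp
      · push Not at hy
        simp [hy]
    have hk : (k : ℝ) * ((1 - Real.exp (-κ)) / k) ≤ 1 - Real.exp (-κ) := by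
      rw [mul_div_assoc']
      exact div_le_of_le_mul₀ k.cast_nonneg (by linarith) (by rw [mul_comm])
    simp only [q, Finset.sum_add_distrib, ← Finset.mul_sum, Finset.sum_const, Finset.card_univ,
      Fintype.card_fin, nsmul_eq_mul]
    nlinarith [Real.exp_pos (-κ)]
  have hq1 : ∀ j y, q j y ≤ 1 := fun j y =>
    (Finset.single_le_sum (fun i _ => (hqpos i y).le) (Finset.mem_univ j)).trans (hqsum y)
  have hqx : ∀ x y j, x ∈ ξ.cell j → dist x y < ε →
      Real.exp (-(κ + M * B.indicator 1 x)) ≤ q j y := by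
    intro x y j hx hxy
    by_cases hxB : x ∈ B
    · refine (Real.exp_le_exp.2 ?_).trans (hq0 j y)
      rw [Set.indicator_of_mem hxB, Pi.one_apply]
      linarith
    · obtain ⟨i, hi⟩ : ∃ i, x ∈ K i := by simpa [hB] using hxB
      obtain rfl : i = j := by
        rw [← ξ.code_eq_iff.2 (hKξ i hi), ξ.code_eq_iff.2 hx]
      rw [Set.indicator_of_notMem hxB, mul_zero, add_zero]
      simp only [q, Set.indicator_of_mem (hKV i x hi y hxy), Pi.one_apply, mul_one]
      exact le_add_of_nonneg_right (div_nonneg (by linarith) k.cast_nonneg)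
  have hpm : ∀ c : T → Fin k, Measurable fun y => ∏ t, q (c t) (F t y) := fun c =>
    Finset.measurable_prod _ fun t _ => (hqm _).comp (hF t).measurable
  have hp0 : ∀ (c : T → Fin k) y, 0 ≤ ∏ t, q (c t) (F t y) := fun c y =>
    Finset.prod_nonneg fun t _ => (hqpos _ _).le
  have hpint : ∀ c : T → Fin k, Integrable (fun y => ∏ t, q (c t) (F t y)) μ := fun c =>
    Integrable.of_bound (hpm c).aestronglyMeasurable 1 <| ae_of_all _ fun y => by
      rw [Real.norm_of_nonneg (hp0 c y)]
      exact Finset.prod_le_one (fun t _ => (hqpos _ _).le) fun t _ => hq1 _ _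
  -- The law of the noisy itinerary of a `μ`-random `y`, with independent noise at each `t`.
  let Q : (T → Fin k) → ℝ := fun c => ∫ y, ∏ t, q (c t) (F t y) ∂μ
  have hQpos : ∀ c, 0 < Q c := fun c => by
    have h : ∫ _, ∏ _t : T, Real.exp (-M) ∂μ ≤ Q c :=
      integral_mono (integrable_const _) (hpint c) fun y =>
        Finset.prod_le_prod (fun _ _ => (Real.exp_pos _).le) fun t _ => hq0 _ _
    rw [integral_const, probReal_univ, one_smul] at h
    exact (Finset.prod_pos fun _ _ => Real.exp_pos _).trans_le h
  have hQ1 : ∑ c, Q c ≤ 1 := by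
    rw [← integral_finsetSum _ fun c _ => hpint c]
    have : ∀ y, ∑ c : T → Fin k, ∏ t, q (c t) (F t y) ≤ 1 := fun y => by
      have h := Finset.prod_univ_sum (fun _ : T => (Finset.univ : Finset (Fin k)))
        fun t j => q j (F t y)
      rw [Fintype.piFinset_univ] at h
      rw [← h]
      exact Finset.prod_le_one (fun t _ => Finset.sum_nonneg fun j _ => (hqpos _ _).le)
        fun t _ => hqsum _
    calc ∫ y, ∑ c : T → Fin k, ∏ t, q (c t) (F t y) ∂μ ≤ ∫ _, (1 : ℝ) ∂μ :=
          integral_mono (integrable_finsetSum _ fun c _ => hpint c) (integrable_const _) this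
      _ = 1 := by simp
  -- Only `y ∈ N x` are kept in the integral defining `Q`; there `F t y` is `ε`-close to `F t x` for
  -- every `t`, so `hqx` bounds each factor.
  have hlog : ∀ x, -Real.log (Q fun t => ξ.code (F t x)) ≤
      Real.log (1 / r) + ∑ t, (κ + M * B.indicator 1 (F t x)) := by
    intro x
    have h1 : r * Real.exp (-∑ t, (κ + M * B.indicator 1 (F t x))) ≤
        Q fun t => ξ.code (F t x) := by
      calc r * Real.exp (-∑ t, (κ + M * B.indicator 1 (F t x)))
          ≤ μ.real (N x) * Real.exp (-∑ t, (κ + M * B.indicator 1 (F t x))) :=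
            mul_le_mul_of_nonneg_right (hNr x) (Real.exp_pos _).le
        _ = ∫ _ in N x, Real.exp (-∑ t, (κ + M * B.indicator 1 (F t x))) ∂μ := by
            rw [setIntegral_const, smul_eq_mul]
        _ ≤ ∫ y in N x, ∏ t, q (ξ.code (F t x)) (F t y) ∂μ := by
            refine setIntegral_mono_on (integrable_const _).integrableOn
              (hpint _).integrableOn (hN x) fun y hy => ?_
            rw [← Finset.sum_neg_distrib, Real.exp_sum]
            exact Finset.prod_le_prod (fun _ _ => (Real.exp_pos _).le) fun t _ =>
              hqx _ _ _ (ξ.code_eq_iff.1 rfl) (hNF x y hy t)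
        _ ≤ Q fun t => ξ.code (F t x) :=
            setIntegral_le_integral (hpint _) (ae_of_all _ fun y => hp0 _ y)
    have h2 := Real.log_le_log (by positivity) h1
    rw [Real.log_mul hr.ne' (Real.exp_pos _).ne', Real.log_exp] at h2
    rw [one_div, Real.log_inv]
    linarith
  have hBint : ∀ t, Integrable (fun x => κ + M * B.indicator 1 (F t x)) μ := fun t =>
    (integrable_const κ).add (((integrable_const (1 : ℝ)).indicator
      ((hF t).measurable hBm)).const_mul M)
  have hBval : ∀ t, ∫ x, (κ + M * B.indicator 1 (F t x)) ∂μ = κ + M * μ.real B := fun t => by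
    have hi : Integrable (fun x => M * B.indicator (1 : X → ℝ) (F t x)) μ :=
      ((integrable_const (1 : ℝ)).indicator ((hF t).measurable hBm)).const_mul M
    have hc : ∫ x, B.indicator (1 : X → ℝ) (F t x) ∂μ = μ.real B := by
      rw [← (hF t).measureReal_preimage hBm.nullMeasurableSet,
        ← integral_indicator_one ((hF t).measurable hBm)]
      rfl
    rw [integral_add (integrable_const κ) hi, integral_const_mul, hc]
    simp
  calc cellEntropy μ (fun c : T → Fin k => (fun x t => ξ.code (F t x)) ⁻¹' {c})
      ≤ ∫ x, -Real.log (Q fun t => ξ.code (F t x)) ∂μ :=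
        cellEntropy_le_of_gibbs hφ (fun c => (hQpos c).le) (fun c _ => hQpos c) hQ1
    _ ≤ ∫ x, (Real.log (1 / r) + ∑ t, (κ + M * B.indicator 1 (F t x))) ∂μ := by
        refine integral_mono ?_ ((integrable_const _).add (integrable_finsetSum _ fun t _ =>
          hBint t)) hlog
        exact (Integrable.of_finite (μ := μ.map fun x t => ξ.code (F t x))
          (f := fun c => -Real.log (Q c))).comp_measurable hφ
    _ = Real.log (1 / r) + Fintype.card T * (κ + M * μ.real B) := by
        rw [integral_add (integrable_const _) (integrable_finsetSum _ fun t _ => hBint t),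
          integral_finsetSum _ fun t _ => hBint t]
        simp [hBval, mul_add]

end Itinerary

/-! ### Affine maps of a compact group -/

/-- A compact metric space has a finite measurable partition into sets of small diameter. -/
theorem exists_measPartition_dist_lt {X : Type*} [PseudoMetricSpace X] [CompactSpace X]
    [MeasurableSpace X] [OpensMeasurableSpace X] {ε : ℝ} (hε : 0 < ε) :
    ∃ (k : ℕ) (ξ : MeasPartition X k), ∀ i, ∀ x ∈ ξ.cell i, ∀ y ∈ ξ.cell i, dist x y < ε := by
  obtain ⟨t, -, ht, hcov⟩ := finite_cover_balls_of_compact (isCompact_univ (X := X)) (half_pos hε)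
  lift t to Finset X using ht
  let b : Fin t.card → Set X := fun i => Metric.ball (t.equivFin.symm i).1 (ε / 2)
  refine ⟨t.card, ⟨disjointed b, fun i => disjointedRec (fun _ _ h => h.diff measurableSet_ball)
    measurableSet_ball, fun i j hij => disjoint_disjointed b hij, ?_⟩, fun i x hx y hy => ?_⟩
  · rw [iUnion_disjointed, Set.eq_univ_iff_forall]
    intro x
    obtain ⟨z, hz, hxz⟩ := Set.mem_iUnion₂.1 (hcov (Set.mem_univ x))
    exact Set.mem_iUnion.2 ⟨t.equivFin ⟨z, hz⟩, by simpa [b] using hxz⟩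
  · have h1 := Metric.mem_ball.1 (disjointed_subset b i hx)
    have h2 := Metric.mem_ball'.1 (disjointed_subset b i hy)
    linarith [dist_triangle x (t.equivFin.symm i).1 y]

section Group

variable {X : Type*} [Group X] {m : ℕ}

theorem wordMap_affineMaps_inv_mul (a : Fin m → X) (A : Fin m → X →* X) (w : List (Fin m))
    (x y : X) : (wordMap (affineMaps a A) w x)⁻¹ * wordMap (affineMaps a A) w y =
      wordMap (fun i => ⇑(A i)) w (x⁻¹ * y) := by
  induction w with
  | nil => rfl
  | cons i w ih =>
    simp only [wordMap, Function.comp_apply, ← ih, affineMaps, map_mul, map_inv]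
    group

theorem affineMaps_one (A : Fin m → X →* X) : affineMaps 1 A = fun i => ⇑(A i) := by
  funext i x
  simp [affineMaps]

theorem wordMap_monoidHom_one (A : Fin m → X →* X) (w : List (Fin m)) :
    wordMap (fun i => ⇑(A i)) w 1 = 1 := by
  induction w with
  | nil => rfl
  | cons i w ih => simp [wordMap, ih]

theorem one_mem_bowenBall [PseudoMetricSpace X] (A : Fin m → X →* X) (w : List (Fin m)) {ε : ℝ}
    (hε : 0 < ε) : (1 : X) ∈ bowenBall (fun i => ⇑(A i)) w ε := by
  simp [bowenBall, wordMap_monoidHom_one, hε]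

theorem bowenBall_mono [PseudoMetricSpace X] (f : Fin m → X → X) (w : List (Fin m)) {ε δ : ℝ}
    (h : ε ≤ δ) : bowenBall f w ε ⊆ bowenBall f w δ :=
  Set.iInter₂_mono fun _ _ => Set.preimage_mono (Metric.ball_subset_ball h)

theorem continuous_wordMap {Y : Type*} [TopologicalSpace Y] {f : Fin m → Y → Y}
    (hf : ∀ i, Continuous (f i)) : ∀ w : List (Fin m), Continuous (wordMap f w)
  | [] => continuous_id
  | i :: w => (hf i).comp (continuous_wordMap hf w)

theorem isOpen_bowenBall [PseudoMetricSpace X] {f : Fin m → X → X} (hf : ∀ i, Continuous (f i))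
    (w : List (Fin m)) (ε : ℝ) : IsOpen (bowenBall f w ε) :=
  isOpen_biInter_finset fun t _ => Metric.isOpen_ball.preimage (continuous_wordMap hf t)

variable [MetricSpace X]

/-- Identifies the Bowen ball of the affine maps at `x` with the left translate by `x` of the one of
the endomorphisms at `1`. -/
theorem inv_mul_mem_bowenBall_iff (hd : ∀ a x y : X, dist (a * x) (a * y) = dist x y)
    (a : Fin m → X) (A : Fin m → X →* X) (w : List (Fin m)) (ε : ℝ) (x y : X) :
    x⁻¹ * y ∈ bowenBall (fun i => ⇑(A i)) w ε ↔ ∀ t ∈ wordSuffixes w,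
      dist (wordMap (affineMaps a A) t x) (wordMap (affineMaps a A) t y) < ε := by
  simp only [bowenBall, Set.mem_iInter, Set.mem_preimage, Metric.mem_ball,
    ← wordMap_affineMaps_inv_mul a]
  refine forall₂_congr fun t _ => ?_
  rw [← hd (wordMap (affineMaps a A) t x), mul_inv_cancel_left, mul_one, dist_comm]

variable [IsTopologicalGroup X] [CompactSpace X] [MeasurableSpace X] [BorelSpace X]
  {μ : Measure X} [μ.IsHaarMeasure] [IsProbabilityMeasure μ]

omit [IsProbabilityMeasure μ] in
-- A continuous surjective endomorphism pushes `μ` to a Haar measure of the same mass, which is `μ`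
-- by uniqueness.
theorem measurePreserving_affineMaps (a : Fin m → X) {A : Fin m → X →* X}
    (hAc : ∀ i, Continuous (A i)) (hAs : ∀ i, Function.Surjective (A i)) (i : Fin m) :
    MeasurePreserving (affineMaps a A i) μ μ :=
  (measurePreserving_mul_left μ (a i)).comp
    (MonoidHom.measurePreserving (hAc i) (hAs i) rfl)

omit [IsTopologicalGroup X] [CompactSpace X] [BorelSpace X] in
theorem measureReal_bowenBall_pos {A : Fin m → X →* X} (hAc : ∀ i, Continuous (A i))
    (w : List (Fin m)) {ε : ℝ} (hε : 0 < ε) :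
    0 < μ.real (bowenBall (fun i => ⇑(A i)) w ε) :=
  ENNReal.toReal_pos ((isOpen_bowenBall hAc w ε).measure_pos μ
    ⟨1, one_mem_bowenBall A w hε⟩).ne' (measure_ne_top _ _)

omit [CompactSpace X] [IsProbabilityMeasure μ] in
theorem measureReal_preimage_inv_mul (x : X) (s : Set X) :
    μ.real ((fun y => x⁻¹ * y) ⁻¹' s) = μ.real s := by
  rw [Measure.real, measure_preimage_mul, Measure.real]

theorem lowerRate_le_semigroupEntropy (hd : ∀ a x y : X, dist (a * x) (a * y) = dist x y)
    (a : Fin m → X) {A : Fin m → X →* X} (hAc : ∀ i, Continuous (A i))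
    (hAs : ∀ i, Function.Surjective (A i)) {ε : ℝ} (hε : 0 < ε) :
    lowerRate μ (fun i => ⇑(A i)) ε ≤ semigroupEntropy μ (affineMaps a A) := by
  obtain ⟨k, ξ, hξ⟩ := exists_measPartition_dist_lt (X := X) hε
  refine le_trans ?_ (le_iSup₂ (f := fun k (ξ : MeasPartition X k) =>
    partitionEntropy μ (affineMaps a A) ξ) k ξ)
  refine limsup_le_limsup (Eventually.of_forall fun n => EReal.coe_le_coe_iff.2 ?_)
  refine mul_le_mul_of_nonneg_left (wordAverage_mono fun w _ => ?_) (by positivity)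
  rw [joinCells_eq]
  refine log_one_div_le_cellEntropy
    (measurable_itinerary (measurePreserving_affineMaps (μ := μ) a hAc hAs) ξ w) fun c => ?_
  rcases (itinerary (affineMaps a A) ξ w ⁻¹' {c}).eq_empty_or_nonempty with h | ⟨x, hx⟩
  · rw [h, measureReal_empty]; exact measureReal_nonneg
  · rw [← measureReal_preimage_inv_mul x (bowenBall _ w ε)]
    refine measureReal_mono fun y hy => ?_
    refine (inv_mul_mem_bowenBall_iff hd a A w ε x y).2 fun t ht => ?_
    exact hξ (c ⟨t, ht⟩) _ (ξ.code_eq_iff.1 (congrFun hx ⟨t, ht⟩)) _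
      (ξ.code_eq_iff.1 (congrFun hy ⟨t, ht⟩))

/-- The radius depends on `ξ` and `κ` but not on `n`, so the upper limit in `n` can be taken at
fixed `ε`. -/
theorem exists_entropyRate_le (hm : 1 ≤ m)
    (hd : ∀ a x y : X, dist (a * x) (a * y) = dist x y)
    (a : Fin m → X) {A : Fin m → X →* X} (hAc : ∀ i, Continuous (A i))
    (hAs : ∀ i, Function.Surjective (A i)) {k : ℕ} (ξ : MeasPartition X k) {κ : ℝ} (hκ : 0 < κ) :
    ∃ ε > 0, ∀ n : ℕ, entropyRate μ (affineMaps a A) ξ n ≤ (1 / (n : ℝ)) *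
      (wordAverage m n fun w => Real.log (1 / μ.real (bowenBall (fun i => ⇑(A i)) w ε))) +
        2 * κ := by
  have hk : 0 < (k : ℝ) := Nat.cast_pos.2 (ξ.code 1).pos
  have heκ : 0 < (1 - Real.exp (-κ)) / k :=
    div_pos (sub_pos.2 (by simpa using hκ)) hk
  obtain ⟨M, hM0, hM⟩ : ∃ M : ℝ, 0 < M ∧ Real.exp (-M) ≤ (1 - Real.exp (-κ)) / k :=
    ((eventually_gt_atTop 0).and
      (Real.tendsto_exp_neg_atTop_nhds_zero.eventually_le_const heκ)).exists
  -- An exceptional set of measure at most `κ / M` makes the error per letter `κ + M * (κ / M) = 2 *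
  -- κ`.
  obtain ⟨ε, hε, K, V, hK, hV, hKξ, hVd, hKV, hμ⟩ :=
    ξ.exists_separated_approx (μ := μ) (div_pos hκ hM0)
  have hg := measurePreserving_affineMaps (μ := μ) a hAc hAs
  refine ⟨ε, hε, fun n => ?_⟩
  have hw : ∀ w : List (Fin m), w.length = n →
      cellEntropy μ (joinCells (affineMaps a A) ξ w) ≤
        Real.log (1 / μ.real (bowenBall (fun i => ⇑(A i)) w ε)) + n * (2 * κ) := by
    rintro w rfl
    have h := cellEntropy_code_le (T := ↥(wordSuffixes w))
      (fun t => MeasurePreserving.wordMap hg t.1) ξ hK hV hKξ hVd hKV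
      (N := fun x => (fun y => x⁻¹ * y) ⁻¹' bowenBall (fun i => ⇑(A i)) w ε)
      (fun x => (measurable_const_mul _) (isOpen_bowenBall hAc w ε).measurableSet)
      (measureReal_bowenBall_pos (μ := μ) hAc w hε)
      (fun x => (measureReal_preimage_inv_mul x _).ge)
      (fun x y hy t => (inv_mul_mem_bowenBall_iff hd a A w ε x y).1 hy t.1 t.2) hκ hM
    rw [Fintype.card_coe, card_wordSuffixes] at h
    rw [joinCells_eq]
    refine h.trans (add_le_add_right (mul_le_mul_of_nonneg_left ?_ (Nat.cast_nonneg _)) _)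
    have := mul_le_mul_of_nonneg_left hμ hM0.le
    rw [mul_div_cancel₀ κ hM0.ne'] at this
    linarith
  have h := wordAverage_mono hw
  rw [wordAverage_add, wordAverage_const hm] at h
  refine (mul_le_mul_of_nonneg_left h (by positivity)).trans ?_
  rw [mul_add]
  refine add_le_add_right ?_ _
  -- For `n = 0` the convention `1 / 0 = 0` kills the error term.
  rcases eq_or_ne n 0 with rfl | hn
  · simpa using hκ.le
  · have : (n : ℝ) ≠ 0 := Nat.cast_ne_zero.2 hn
    field_simp
    exact le_rfl

/-- Together with `lowerRate_le_semigroupEntropy` this shows that the entropy equals the supremum of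
`lowerRate` over `ε > 0`. -/
theorem semigroupEntropy_le_of_lowerRate_le (hm : 1 ≤ m)
    (hd : ∀ a x y : X, dist (a * x) (a * y) = dist x y)
    (a : Fin m → X) {A : Fin m → X →* X} (hAc : ∀ i, Continuous (A i))
    (hAs : ∀ i, Function.Surjective (A i)) {L : EReal}
    (hL : ∀ ε > 0, lowerRate μ (fun i => ⇑(A i)) ε ≤ L) :
    semigroupEntropy μ (affineMaps a A) ≤ L := by
  refine iSup₂_le fun k ξ => EReal.le_of_forall_lt_iff_le.1 fun z hz => ?_
  -- The gap `z - z'` absorbs the error `2 * κ`.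
  obtain ⟨z', hLz', hz'z⟩ := EReal.lt_iff_exists_real_btwn.1 hz
  have hκ : 0 < (z - z') / 2 := half_pos (sub_pos.2 (EReal.coe_lt_coe_iff.1 hz'z))
  obtain ⟨ε, hε, h⟩ := exists_entropyRate_le (μ := μ) hm hd a hAc hAs ξ hκ
  refine limsup_le_of_le (by isBoundedDefault) ?_
  filter_upwards [eventually_lt_of_limsup_lt ((hL ε hε).trans_lt hLz')] with n hn
  rw [EReal.coe_le_coe_iff]
  linarith [h n, EReal.coe_lt_coe_iff.1 hn]

omit [IsTopologicalGroup X] [CompactSpace X] [BorelSpace X] in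
-- Only `ε > 0` is allowed: otherwise the balls are empty for nonempty words, and `1 / 0 = 0` can
-- spoil monotonicity.
theorem lowerRate_antitoneOn {A : Fin m → X →* X} (hAc : ∀ i, Continuous (A i)) :
    AntitoneOn (lowerRate μ fun i => ⇑(A i)) (Set.Ioi 0) := by
  intro ε hε δ hδ hεδ
  refine limsup_le_limsup (Eventually.of_forall fun n => EReal.coe_le_coe_iff.2 ?_)
  refine mul_le_mul_of_nonneg_left (wordAverage_mono fun w _ => ?_) (by positivity)
  exact Real.log_le_log (one_div_pos.2 (measureReal_bowenBall_pos hAc w hδ))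
    (one_div_le_one_div_of_le (measureReal_bowenBall_pos hAc w hε)
      (measureReal_mono (bowenBall_mono _ w hεδ)))

omit [IsTopologicalGroup X] [CompactSpace X] [BorelSpace X] in
theorem upperRate_antitoneOn (hm : 1 ≤ m) {A : Fin m → X →* X} (hAc : ∀ i, Continuous (A i)) :
    AntitoneOn (upperRate μ fun i => ⇑(A i)) (Set.Ioi 0) := by
  intro ε hε δ hδ hεδ
  refine limsup_le_limsup (Eventually.of_forall fun n => EReal.coe_le_coe_iff.2 ?_)
  refine mul_le_mul_of_nonneg_left (Real.log_le_log
    (wordAverage_pos hm fun w => one_div_pos.2 (measureReal_bowenBall_pos hAc w hδ))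
    (wordAverage_mono fun w _ => ?_)) (by positivity)
  exact one_div_le_one_div_of_le (measureReal_bowenBall_pos hAc w hε)
    (measureReal_mono (bowenBall_mono _ w hεδ))

omit [IsTopologicalGroup X] [CompactSpace X] [BorelSpace X] in
theorem lowerRate_le_upperRate (hm : 1 ≤ m) {A : Fin m → X →* X} (hAc : ∀ i, Continuous (A i))
    {ε : ℝ} (hε : 0 < ε) :
    lowerRate μ (fun i => ⇑(A i)) ε ≤ upperRate μ (fun i => ⇑(A i)) ε := by
  refine limsup_le_limsup (Eventually.of_forall fun n => EReal.coe_le_coe_iff.2 ?_)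
  exact mul_le_mul_of_nonneg_left (wordAverage_log_le hm fun w =>
    one_div_pos.2 (measureReal_bowenBall_pos hAc w hε)) (by positivity)

end Group

theorem mainTheorem3 {X : Type*} [Group X] [MetricSpace X] [IsTopologicalGroup X]
    [CompactSpace X] [MeasurableSpace X] [BorelSpace X]
    (hd : ∀ a x y : X, dist (a * x) (a * y) = dist x y)
    (μ : Measure X) [μ.IsHaarMeasure] [IsProbabilityMeasure μ]
    {m : ℕ} (hm : 1 ≤ m) (A : Fin m → X →* X) (hAc : ∀ i, Continuous (A i))
    (hAs : ∀ i, Function.Surjective (A i)) (a : Fin m → X) :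
    (∀ (k : ℕ) (ξ : MeasPartition X k),
      Tendsto (fun n : ℕ => ((entropyRate μ (affineMaps a A) ξ n : ℝ) : EReal)) atTop
        (𝓝 (partitionEntropy μ (affineMaps a A) ξ)) ∧
      Tendsto (fun n : ℕ => ((entropyRate μ (fun i => ⇑(A i)) ξ n : ℝ) : EReal)) atTop
        (𝓝 (partitionEntropy μ (fun i => ⇑(A i)) ξ))) ∧
    ∃ L U : EReal,
      Tendsto (fun ε : ℝ => lowerRate μ (fun i => ⇑(A i)) ε) (𝓝[>] 0) (𝓝 L) ∧
      Tendsto (fun ε : ℝ => upperRate μ (fun i => ⇑(A i)) ε) (𝓝[>] 0) (𝓝 U) ∧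
      L ≤ semigroupEntropy μ (affineMaps a A) ∧
      semigroupEntropy μ (affineMaps a A) ≤ U ∧
      L ≤ semigroupEntropy μ (fun i => ⇑(A i)) ∧
      semigroupEntropy μ (fun i => ⇑(A i)) ≤ U := by
  have hg := measurePreserving_affineMaps (μ := μ) a hAc hAs
  have hA := measurePreserving_affineMaps (μ := μ) 1 hAc hAs
  have hl := lowerRate_antitoneOn (μ := μ) hAc
  have hu := upperRate_antitoneOn (μ := μ) hm hAc
  have hLU : ∀ ε > 0, lowerRate μ (fun i => ⇑(A i)) ε ≤
      sSup (upperRate μ (fun i => ⇑(A i)) '' Set.Ioi 0) := fun ε hε =>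
    (lowerRate_le_upperRate hm hAc hε).trans (le_sSup (Set.mem_image_of_mem _ hε))
  have lower : ∀ b : Fin m → X, sSup (lowerRate μ (fun i => ⇑(A i)) '' Set.Ioi 0) ≤
      semigroupEntropy μ (affineMaps b A) := fun b => sSup_le <| by
    rintro _ ⟨ε, hε, rfl⟩
    exact lowerRate_le_semigroupEntropy hd b hAc hAs hε
  have upper : ∀ b : Fin m → X, semigroupEntropy μ (affineMaps b A) ≤
      sSup (upperRate μ (fun i => ⇑(A i)) '' Set.Ioi 0) := fun b =>
    semigroupEntropy_le_of_lowerRate_le hm hd b hAc hAs hLU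
  -- The endomorphisms are the affine maps with all constants `1`.
  rw [affineMaps_one] at hA
  -- `L` and `U` are the suprema over `ε > 0`, to which antitone functions converge at `0` from the
  -- right.
  refine ⟨fun k ξ => ⟨tendsto_entropyRate hm hg ξ, tendsto_entropyRate hm hA ξ⟩, _, _,
    hl.tendsto_nhdsGT (OrderTop.bddAbove _), hu.tendsto_nhdsGT (OrderTop.bddAbove _),
    lower a, upper a, ?_, ?_⟩
  · simpa only [affineMaps_one] using lower 1
  · simpa only [affineMaps_one] using upper 1
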